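/- Let $\mathcal A$ be a $C^*$-algebra and $E$ a Hilbert $C^*$-module over $\mathcal A$ with $\mathcal A$-valued inner product $\langle\cdot,\cdot\rangle$. Let $\mathcal L(E)$ be the unital $*$-algebra of adjointable operators on $E$, and equip $E\oplus E$ with $\langle (x_1,y_1),(x_2,y_2)\rangle=\langle x_1,x_2\rangle+\langle y_1,y_2\rangle$. For a subset $S$ of a Hilbert module, $S^\perp$ is the set of all $x$ with $\langle x,y\rangle=0$ for every $y\in S$. An operator $t$ on $E$ is a $\mathbb C$-linear and $\mathcal A$-linear map $t:\mathcal D(t)\to E$ on an $\mathcal A$-submodule $\mathcal D(t)\subseteq E$; its graph is $\mathcal G(t)=\{(x,tx):x\in\mathcal D(t)\}$. It is called *graph regular* if $\mathcal D(t)^\perp=\{0\}$, $\mathcal G(t)^{\perp\perp}=\mathcal G(t)$ and $\mathcal G(t)\oplus\mathcal G(t)^\perp=E\oplus E$. In that case its adjoint $t^*$ is the operator whose graph consists of all $(y,z)\in E\oplus E$ with $\langle tx,y\rangle=\langle x,z\rangle$ for all $x\in\mathcal D(t)$; $t$ is called *normal* if $t^*t=tt^*$ (including equality of domains). Let $C_0(\mathbb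 C)^\sim=C_0(\mathbb C)\oplus\mathbb C$ be the unitization of $C_0(\mathbb C)$, let $\zeta$ be the identity function of $\mathbb C$, and let $$a_\zeta=\frac{1}{1+|\zeta|^2},\qquad b_\zeta=\frac{\zeta}{1+|\zeta|^2}\qquad\text{in } C_0(\mathbb C).$$ For a $*$-homomorphism $\varphi:C_0(\mathbb C)^\sim\to\mathcal L(E)$ with $\mathcal N(\varphi(a_\zeta)):=\{x\in E:\varphi(a_\zeta)x=0\}=\{0\}$, let $\varphi(\zeta)$ be the orthogonal closure of the operator $\varphi(a_\zeta)x\mapsto\varphi(b_\zeta)x$ $(x\in E)$, that is, the operator with graph $$\mathcal G(\varphi(\zeta))=\{(\varphi(a_\zeta)x,\varphi(b_\zeta)x):x\in E\}^{\perp\perp}.$$ **Theorem.** Let $t$ be a normal graph regular operator on $E$. Then there is a unique $*$-homomorphism $\varphi_t:C_0(\mathbb C)^\sim\to\mathcal L(E)$ such that $$\mathcal N(\varphi_t(a_\zeta))=\{0\}\qquad\text{and}\qquad \varphi_t(\zeta)=t .$$ Moreover, $\varphi_t$ is unital, and the uniqueness holds among all (not necessarily unital) $*$-homomorphisms. -/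

import Mathlib

open scoped ZeroAtInfty

noncomputable section

namespace GraphRegular

section Adjointable

variable (A E : Type*) [NonUnitalCStarAlgebra A] [PartialOrder A] [StarOrderedRing A]
  [NormedAddCommGroup E] [NormedSpace ℂ E] [SMul A E] [CStarModule A E]

/-- Nondegeneracy of the `A`-valued inner product. -/
theorem ext_inner_left' {y z : E} (h : ∀ x : E, inner A x y = inner A x z) : y = z := by
  have h1 : inner A (y - z) (y - z) = 0 := by
    rw [CStarModule.inner_sub_right, h, sub_self]
  exact sub_eq_zero.mp (CStarModule.inner_self.mp h1)

/-- The algebra `𝓛(E)` of adjointable operators on the Hilbert `A`-module `E`: the everywhere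
defined operators `T` that have an everywhere defined adjoint `S`, that is
`⟪T x, y⟫ = ⟪x, S y⟫` for all `x, y`. (Boundedness and `A`-linearity of such `T` and `S` are
automatic on a Hilbert module.) Multiplication is composition. -/
def Adjointable : Subalgebra ℂ (E →L[ℂ] E) where
  carrier := {T | ∃ S : E →L[ℂ] E, ∀ x y : E, inner A (T x) y = inner A x (S y)}
  mul_mem' := by
    rintro T T' ⟨S, hS⟩ ⟨S', hS'⟩
    exact ⟨S' * S, fun x y => by simp [hS, hS']⟩
  add_mem' := by
    rintro T T' ⟨S, hS⟩ ⟨S', hS'⟩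
    exact ⟨S + S', fun x y => by simp [hS, hS']⟩
  algebraMap_mem' := by
    intro c
    refine ⟨algebraMap ℂ (E →L[ℂ] E) (star c), fun x y => ?_⟩
    simp [Algebra.algebraMap_eq_smul_one]

variable {A E}

/-- The adjoint of an adjointable operator; it is characterized by `inner_star_right`. -/
instance : Star (Adjointable A E) where
  star T := ⟨T.2.choose, T.1, fun x y => by
    rw [← CStarModule.star_inner, ← T.2.choose_spec y x, CStarModule.star_inner]⟩

theorem inner_star_right (T : Adjointable A E) (x y : E) :
    inner A (T.1 x) y = inner A x ((star T).1 y) :=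
  T.2.choose_spec x y

theorem star_eq_of_inner {T S : Adjointable A E}
    (h : ∀ x y : E, inner A (T.1 x) y = inner A x (S.1 y)) : star T = S := by
  apply Subtype.ext
  ext y
  exact ext_inner_left' A E fun x => by rw [← inner_star_right, h]

instance : StarRing (Adjointable A E) where
  star_involutive T := star_eq_of_inner fun x y => by
    rw [← CStarModule.star_inner, ← inner_star_right, CStarModule.star_inner]
  star_mul T S := star_eq_of_inner fun x y => by
    simp [inner_star_right]
  star_add T S := star_eq_of_inner fun x y => by
    simp [inner_star_right]

instance : StarModule ℂ (Adjointable A E) where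
  star_smul c T := star_eq_of_inner fun x y => by
    simp [inner_star_right]

end Adjointable

section Operators

variable (A : Type*) {E F : Type*} [NonUnitalCStarAlgebra A] [PartialOrder A]
  [StarOrderedRing A]
  [NormedAddCommGroup E] [NormedSpace ℂ E] [SMul A E] [CStarModule A E]
  [NormedAddCommGroup F] [NormedSpace ℂ F] [SMul A F] [CStarModule A F]

/-- The orthogonal complement of a subset of the direct sum `E ⊕ F`, with respect to the
`A`-valued inner product `⟪(e₁, f₁), (e₂, f₂)⟫ = ⟪e₁, e₂⟫ + ⟪f₁, f₂⟫`. -/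
def orthSum (S : Set (E × F)) : Set (E × F) :=
  {p | ∀ q ∈ S, inner A p.1 q.1 + inner A p.2 q.2 = 0}

/-- A partially defined `ℂ`-linear map `t : E → F` is an operator between the Hilbert `A`-modules
if its domain is an `A`-submodule and `t` is `A`-linear on it. -/
def IsOperator (t : E →ₗ.[ℂ] F) : Prop :=
  ∀ (a : A) (x : E) (y : F), (x, y) ∈ t.graph → (a • x, a • y) ∈ t.graph

/-- The domain of `t` is essential: its orthogonal complement in `E` is zero. -/
def IsEssentiallyDefined (t : E →ₗ.[ℂ] F) : Prop :=
  ∀ x : E, (∀ y ∈ t.domain, inner A x y = 0) → x = 0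

/-- The graph of `t` equals its second orthogonal complement in `E ⊕ F`. -/
def IsOrthogonallyClosed (t : E →ₗ.[ℂ] F) : Prop :=
  orthSum A (orthSum A (t.graph : Set (E × F))) = (t.graph : Set (E × F))

/-- Graph regular operators: essentially defined, orthogonally closed operators whose graph is
orthogonally complemented, that is `𝒢(t) ⊕ 𝒢(t)^⊥ = E ⊕ F`. -/
structure IsGraphRegular (t : E →ₗ.[ℂ] F) : Prop where
  isOperator : IsOperator A t
  essentiallyDefined : IsEssentiallyDefined A t
  orthogonallyClosed : IsOrthogonallyClosed A t
  complemented : ∀ p : E × F, ∃ q ∈ t.graph, ∃ r ∈ orthSum A (t.graph : Set (E × F)), p = q + r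

/-- The graph of the adjoint `t^*` : all `(y, z)` with `⟪t x, y⟫ = ⟪x, z⟫` for every `x` in the
domain of `t`. If `t` is essentially defined, then `z` is determined by `y`, so that this is
the graph of an operator. -/
def adjointGraph (t : E →ₗ.[ℂ] F) : Set (F × E) :=
  {p | ∀ x : t.domain, inner A (t x) p.1 = inner A (x : E) p.2}

/-- `t^* t = t t^*` as operators, domains included; both products carry the maximal domain of a
composition of partially defined operators. -/
def IsNormalOp (t : E →ₗ.[ℂ] E) : Prop :=
  ∀ x w : E, (∃ y, (x, y) ∈ t.graph ∧ (y, w) ∈ adjointGraph A t) ↔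
    (∃ y, (x, y) ∈ adjointGraph A t ∧ (y, w) ∈ t.graph)

end Operators

section Zeta

/-- The function `a_ζ(z) = (1 + |z|²)⁻¹` in `C₀(ℂ)`. -/
def aZeta : C₀(ℂ, ℂ) where
  toFun z := ((1 + ‖z‖ ^ 2 : ℝ) : ℂ)⁻¹
  continuous_toFun := by
    refine Continuous.inv₀ (by fun_prop) fun z => ?_
    exact Complex.ofReal_ne_zero.mpr (by positivity)
  zero_at_infty' := by
    have h : Filter.Tendsto (fun z : ℂ => (1 + ‖z‖ ^ 2 : ℝ)) (Filter.cocompact ℂ) Filter.atTop :=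
      Filter.tendsto_atTop_add_const_left _ _
        ((Filter.tendsto_pow_atTop two_ne_zero).comp (tendsto_norm_cocompact_atTop (E := ℂ)))
    have h' := (Complex.continuous_ofReal.tendsto 0).comp h.inv_tendsto_atTop
    simpa [Function.comp_def] using h'

/-- The function `b_ζ(z) = z (1 + |z|²)⁻¹` in `C₀(ℂ)`. -/
def bZeta : C₀(ℂ, ℂ) where
  toFun z := z * ((1 + ‖z‖ ^ 2 : ℝ) : ℂ)⁻¹
  continuous_toFun := by
    refine Continuous.mul continuous_id (Continuous.inv₀ (by fun_prop) fun z => ?_)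
    exact Complex.ofReal_ne_zero.mpr (by positivity)
  zero_at_infty' := by
    have h := (tendsto_norm_cocompact_atTop (E := ℂ)).inv_tendsto_atTop
    refine squeeze_zero_norm (fun z => ?_) h
    rcases eq_or_ne z 0 with rfl | hz
    · simp
    have hz' : 0 < ‖z‖ := norm_pos_iff.mpr hz
    rw [norm_mul, norm_inv, Complex.norm_real, Real.norm_of_nonneg (by positivity),
      Pi.inv_apply, ← div_eq_mul_inv, div_le_iff₀ (by positivity), inv_mul_eq_div,
      le_div_iff₀ hz']
    nlinarith

variable {A E : Type*} [NonUnitalCStarAlgebra A] [PartialOrder A] [StarOrderedRing A]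
  [NormedAddCommGroup E] [NormedSpace ℂ E] [SMul A E] [CStarModule A E]

/-- `𝒩(φ(a_ζ)) = {0}`. -/
def HasTrivialNullSpace (φ : Unitization ℂ C₀(ℂ, ℂ) →⋆ₙₐ[ℂ] Adjointable A E) : Prop :=
  ∀ x : E, (φ (aZeta : Unitization ℂ C₀(ℂ, ℂ))).1 x = 0 → x = 0

/-- The graph of `φ(ζ)`, where `ζ` is the identity function of `ℂ`: the operator `φ(ζ)` is the
orthogonal closure of the map `φ(a_ζ) x ↦ φ(b_ζ) x`, `x ∈ E`. -/
def graphZeta (φ : Unitization ℂ C₀(ℂ, ℂ) →⋆ₙₐ[ℂ] Adjointable A E) : Set (E × E) :=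
  orthSum A (orthSum A (Set.range fun x : E =>
    ((φ (aZeta : Unitization ℂ C₀(ℂ, ℂ))).1 x, (φ (bZeta : Unitization ℂ C₀(ℂ, ℂ))).1 x)))

/-- `φ` is a functional calculus for `t`: `𝒩(φ(a_ζ)) = {0}` and `φ(ζ) = t`. -/
def IsFunctionalCalculus (t : E →ₗ.[ℂ] E)
    (φ : Unitization ℂ C₀(ℂ, ℂ) →⋆ₙₐ[ℂ] Adjointable A E) : Prop :=
  HasTrivialNullSpace φ ∧ graphZeta φ = (t.graph : Set (E × E))

end Zeta

end GraphRegular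

end

open scoped ZeroAtInfty

noncomputable section

namespace GraphRegular

/-! ### The C⋆-algebra of adjointable operators -/

section CStar

variable {A E : Type*} [NonUnitalCStarAlgebra A] [PartialOrder A] [StarOrderedRing A]
  [NormedAddCommGroup E] [NormedSpace ℂ E] [SMul A E] [CStarModule A E]

/-! The operator `t` is encoded by `a = (1 + t^* t)⁻¹` and `b = t (1 + t^* t)⁻¹`, the first column
of the projection of `E ⊕ E` onto the graph of `t`. Normality makes the whole projection `P = !![a,
b^*; b, 1 - a]`, and `P² = P` becomes the relations satisfied by `a_ζ` and `b_ζ`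
(`exists_isResolventPair`).

Existence: `a` and `b` generate a commutative C⋆-algebra. On its spectrum `b / a` is a continuous
function to the Riemann sphere, infinite where `a` vanishes, and composing with it is the calculus
(`IsResolventPair.exists_starAlgHom`). If `a` is injective, the orthogonal closure of the range of
`(a, b)` is the range of `P` (`IsResolventPair.orthSum_orthSum_range`).

Uniqueness: the graph determines `P`, hence `a` and `b` (`IsResolventPair.eq_of_resolventGraph_eq`),
and by Stone–Weierstrass these determine the homomorphism (`unitization_starAlgHom_ext`). -/

instance : CStarRing (Adjointable A E) where
  norm_mul_self_le T := by
    have hle : ‖T.1‖ ≤ √‖star T * T‖ := by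
      refine T.1.opNorm_le_bound (Real.sqrt_nonneg _) fun x => ?_
      have h : ‖T.1 x‖ ^ 2 ≤ ‖star T * T‖ * ‖x‖ ^ 2 := by
        rw [CStarModule.norm_sq_eq A, inner_star_right]
        calc ‖inner A x ((star T * T).1 x)‖ ≤ ‖x‖ * ‖(star T * T).1 x‖ :=
              CStarModule.norm_inner_le E
          _ ≤ ‖x‖ * (‖star T * T‖ * ‖x‖) := by gcongr; exact (star T * T).1.le_opNorm x
          _ = ‖star T * T‖ * ‖x‖ ^ 2 := by ring
      calc ‖T.1 x‖ ≤ √(‖star T * T‖ * ‖x‖ ^ 2) := Real.le_sqrt_of_sq_le h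
        _ = √‖star T * T‖ * ‖x‖ := by
          rw [Real.sqrt_mul (norm_nonneg (star T * T)), Real.sqrt_sq (norm_nonneg _)]
    calc ‖T‖ * ‖T‖ ≤ √‖star T * T‖ * √‖star T * T‖ :=
          mul_self_le_mul_self (norm_nonneg _) hle
      _ = ‖star T * T‖ := Real.mul_self_sqrt (norm_nonneg _)

variable [CompleteSpace E]

/-- Since the adjoint is isometric, the adjoints of a Cauchy sequence converge too, and the two
limits are adjoint to each other. -/
instance : CompleteSpace (Adjointable A E) := by
  refine Metric.complete_of_cauchySeq_tendsto fun u hu => ?_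
  have hu₁ : CauchySeq fun n => (u n).1 := hu.map (uniformContinuous_subtype_val)
  have hu₂ : CauchySeq fun n => (star (u n)).1 :=
    (hu.map (starₗᵢ ℂ : Adjointable A E ≃ₗᵢ⋆[ℂ] _).isometry.uniformContinuous).map uniformContinuous_subtype_val
  obtain ⟨T, hT⟩ := cauchySeq_tendsto_of_complete hu₁
  obtain ⟨S, hS⟩ := cauchySeq_tendsto_of_complete hu₂
  have happ : ∀ {v : ℕ → E →L[ℂ] E} {V : E →L[ℂ] E},
      Filter.Tendsto v Filter.atTop (nhds V) → ∀ x : E,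
      Filter.Tendsto (fun n => v n x) Filter.atTop (nhds (V x)) := fun h x =>
    ((ContinuousLinearMap.apply ℂ E x).continuous.tendsto _).comp h
  have hTS : ∀ x y : E, inner A (T x) y = inner A x (S y) := fun x y => by
    have h₁ := (CStarModule.continuous_inner (A := A).tendsto (T x, y)).comp
      ((happ hT x).prodMk_nhds tendsto_const_nhds)
    have h₂ := (CStarModule.continuous_inner (A := A).tendsto (x, S y)).comp
      (Filter.Tendsto.prodMk_nhds tendsto_const_nhds (happ hS y))
    refine tendsto_nhds_unique h₁ (h₂.congr fun n => ?_)
    exact (inner_star_right (u n) x y).symm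
  exact ⟨⟨T, S, hTS⟩, tendsto_subtype_rng.2 hT⟩

instance : CStarAlgebra (Adjointable A E) where

/-- A map with an adjoint is linear and bounded, by the closed graph theorem. -/
theorem exists_continuousLinearMap_of_adjoint {f g : E → E}
    (h : ∀ x y, inner A (f x) y = inner A x (g y)) : ∃ T : E →L[ℂ] E, ∀ x, T x = f x := by
  have h' : ∀ x y, inner A y (f x) = inner A (g y) x := fun x y => by
    rw [← CStarModule.star_inner, h, CStarModule.star_inner]
  let T : E →ₗ[ℂ] E :=
    { toFun := f
      map_add' := fun x y => ext_inner_left' A E fun z => by simp [h']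
      map_smul' := fun c x => ext_inner_left' A E fun z => by simp [h'] }
  refine ⟨⟨T, T.continuous_of_seq_closed_graph fun u x y hu hTu => ?_⟩, fun x => rfl⟩
  refine ext_inner_left' A E fun z => ?_
  have h₁ := (CStarModule.continuous_inner (A := A).tendsto (z, y)).comp
    (Filter.Tendsto.prodMk_nhds tendsto_const_nhds hTu)
  have h₂ := (CStarModule.continuous_inner (A := A).tendsto (g z, x)).comp
    (Filter.Tendsto.prodMk_nhds tendsto_const_nhds hu)
  refine tendsto_nhds_unique h₁ ?_
  rw [show inner A z (T x) = inner A (g z) x from h' x z]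
  exact h₂.congr fun n => (h' (u n) z).symm

theorem exists_adjointable {f g : E → E} (h : ∀ x y, inner A (f x) y = inner A x (g y)) :
    ∃ T : Adjointable A E, (∀ x, T.1 x = f x) ∧ ∀ y, (star T).1 y = g y := by
  obtain ⟨T, hT⟩ := exists_continuousLinearMap_of_adjoint h
  obtain ⟨S, hS⟩ := exists_continuousLinearMap_of_adjoint (A := A) (f := g) (g := f)
    fun x y => by rw [← CStarModule.star_inner, ← h, CStarModule.star_inner]
  refine ⟨⟨T, S, fun x y => by rw [hT, hS, h]⟩, hT, fun y => ?_⟩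
  refine ext_inner_left' A E fun x => ?_
  rw [← inner_star_right, ← h, hT]

end CStar

/-! ### Resolvent pairs and homomorphisms on `C₀(ℂ)^~` -/

section ZetaCalculus

open Filter Topology

/-- The algebraic relations between `(1 + |ζ|²)⁻¹` and `ζ (1 + |ζ|²)⁻¹`. -/
structure IsResolventPair {R : Type*} [NonUnitalRing R] [StarRing R] (a b : R) : Prop where
  star_left : star a = a
  star_mul_self : star b * b = a - a * a
  mul_star_self : b * star b = a - a * a
  commute : a * b = b * a

theorem IsResolventPair.map {R S F : Type*} [NonUnitalRing R] [StarRing R] [NonUnitalRing S]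
    [StarRing S] [FunLike F R S] [NonUnitalRingHomClass F R S] [StarHomClass F R S]
    {a b : R} (h : IsResolventPair a b) (f : F) : IsResolventPair (f a) (f b) where
  star_left := by rw [← map_star, h.star_left]
  star_mul_self := by rw [← map_star, ← map_mul, h.star_mul_self, map_sub, map_mul]
  mul_star_self := by rw [← map_star, ← map_mul, h.mul_star_self, map_sub, map_mul]
  commute := by rw [← map_mul, h.commute, map_mul]

theorem IsResolventPair.commute_star {R : Type*} [NonUnitalRing R] [StarRing R] {a b : R}
    (h : IsResolventPair a b) : star b * a = a * star b := by
  simpa [h.star_left] using congrArg star h.commute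

theorem aZeta_apply (z : ℂ) : aZeta z = ((1 + ‖z‖ ^ 2 : ℝ) : ℂ)⁻¹ := rfl

theorem bZeta_apply (z : ℂ) : bZeta z = z * ((1 + ‖z‖ ^ 2 : ℝ) : ℂ)⁻¹ := rfl

theorem one_add_norm_sq_ne_zero (z : ℂ) : ((1 + ‖z‖ ^ 2 : ℝ) : ℂ) ≠ 0 :=
  Complex.ofReal_ne_zero.mpr (by positivity)

theorem aZeta_ne_zero (z : ℂ) : aZeta z ≠ 0 := inv_ne_zero (one_add_norm_sq_ne_zero z)

theorem bZeta_eq_mul_aZeta (z : ℂ) : bZeta z = z * aZeta z := rfl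

theorem isResolventPair_aZeta_bZeta : IsResolventPair aZeta bZeta := by
  have h : ∀ z : ℂ, star (bZeta z) * bZeta z = aZeta z - aZeta z * aZeta z := fun z => by
    have hz : (starRingEnd ℂ) z * z = (‖z‖ : ℂ) ^ 2 := Complex.conj_mul' z
    have h0 := one_add_norm_sq_ne_zero z
    rw [bZeta_apply, aZeta_apply, RCLike.star_def, map_mul, map_inv₀, Complex.conj_ofReal]
    field_simp
    rw [hz]
    push_cast
    ring
  refine ⟨?_, ?_, ?_, ?_⟩ <;> ext z
  · simp [aZeta_apply, -Complex.ofReal_add]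
  · simpa using h z
  · simpa [mul_comm] using h z
  · simp [mul_comm]

/-- Divide `β^* β = α - α²` by `α²`, with `α` real. Thus `α` is `a_ζ` composed with `β / α`, and `β
/ α` is unbounded near zeros of `α` that are limits of nonzeros. -/
theorem IsResolventPair.one_add_norm_div_sq {X : Type*} [TopologicalSpace X] {α β : C(X, ℂ)}
    (h : IsResolventPair α β) {x : X} (hx : α x ≠ 0) :
    ((1 + ‖β x / α x‖ ^ 2 : ℝ) : ℂ) = (α x)⁻¹ := by
  have hα : (starRingEnd ℂ) (α x) = α x := DFunLike.congr_fun h.star_left x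
  have hβ : (starRingEnd ℂ) (β x) * β x = α x - α x * α x :=
    DFunLike.congr_fun h.star_mul_self x
  push_cast
  rw [← Complex.conj_mul', map_div₀, hα, div_mul_div_comm, hβ]
  field_simp
  ring

theorem IsResolventPair.continuous_ite {X : Type*} [TopologicalSpace X] {α β : C(X, ℂ)}
    (h : IsResolventPair α β) (f : C₀(ℂ, ℂ)) :
    Continuous fun x => if α x = 0 then 0 else f (β x / α x) := by
  refine continuous_iff_continuousAt.2 fun x => ?_
  by_cases hx : α x = 0
  · rw [ContinuousAt, if_pos hx]
    -- Near a zero of `α`, on the set where `α ≠ 0`, `1 + |β / α|² = 1 / α` tends to infinity, and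
    -- `f` vanishes at infinity.
    refine Tendsto.if tendsto_const_nhds ?_
    refine (zero_at_infty f).comp ?_
    rw [← Metric.cobounded_eq_cocompact, ← tendsto_norm_atTop_iff_cobounded]
    have hα : Tendsto α (𝓝 x ⊓ 𝓟 {y | ¬α y = 0}) (𝓝[≠] 0) := by
      refine tendsto_nhdsWithin_iff.2 ⟨?_, ?_⟩
      · exact (hx ▸ (α.continuous.tendsto x)).mono_left inf_le_left
      · exact eventually_of_mem (mem_inf_of_right (mem_principal_self _)) fun y hy => hy
    have hsq : Tendsto (fun y => 1 + ‖β y / α y‖ ^ 2) (𝓝 x ⊓ 𝓟 {y | ¬α y = 0}) atTop := by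
      refine (tendsto_norm_inv_nhdsNE_zero_atTop.comp hα).congr' ?_
      refine eventually_of_mem (mem_inf_of_right (mem_principal_self _)) fun y hy => ?_
      change ‖(α y)⁻¹‖ = _
      rw [← h.one_add_norm_div_sq hy, Complex.norm_real, Real.norm_of_nonneg (by positivity)]
    refine tendsto_atTop_mono' _ (Eventually.of_forall fun y => ?_)
      (Real.tendsto_sqrt_atTop.comp (tendsto_atTop_add_const_left _ (-1) hsq))
    change √(-1 + (1 + ‖β y / α y‖ ^ 2)) ≤ ‖β y / α y‖
    rw [neg_add_cancel_left, Real.sqrt_sq (norm_nonneg _)]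
  · have hne : ∀ᶠ y in 𝓝 x, α y ≠ 0 := α.continuous.continuousAt.eventually_ne hx
    have hf : ContinuousAt (fun y => f (β y / α y)) x :=
      f.continuous.continuousAt.comp (β.continuous.continuousAt.div α.continuous.continuousAt hx)
    exact hf.congr (hne.mono fun y hy => (if_neg hy).symm)

/-- Composition with `β / α`, where functions in `C₀(ℂ)` take the value `0` at `∞`. -/
def IsResolventPair.compDiv {X : Type*} [TopologicalSpace X] {α β : C(X, ℂ)}
    (h : IsResolventPair α β) : C₀(ℂ, ℂ) →⋆ₙₐ[ℂ] C(X, ℂ) where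
  toFun f := ⟨_, h.continuous_ite f⟩
  map_smul' c f := by ext x; simp
  map_zero' := by ext x; simp
  map_add' f g := by ext x; by_cases hx : α x = 0 <;> simp [hx]
  map_mul' f g := by ext x; by_cases hx : α x = 0 <;> simp [hx]
  map_star' f := by ext x; by_cases hx : α x = 0 <;> simp [hx]

theorem IsResolventPair.compDiv_apply {X : Type*} [TopologicalSpace X] {α β : C(X, ℂ)}
    (h : IsResolventPair α β) (f : C₀(ℂ, ℂ)) (x : X) :
    h.compDiv f x = if α x = 0 then 0 else f (β x / α x) := rfl

theorem IsResolventPair.compDiv_aZeta {X : Type*} [TopologicalSpace X] {α β : C(X, ℂ)}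
    (h : IsResolventPair α β) : h.compDiv aZeta = α := by
  ext x
  rw [h.compDiv_apply]
  split_ifs with hx
  · exact hx.symm
  · rw [aZeta_apply, h.one_add_norm_div_sq hx, inv_inv]

theorem IsResolventPair.compDiv_bZeta {X : Type*} [TopologicalSpace X] {α β : C(X, ℂ)}
    (h : IsResolventPair α β) : h.compDiv bZeta = β := by
  ext x
  rw [h.compDiv_apply]
  split_ifs with hx
  -- Where `α` vanishes, this relation forces `β` to vanish.
  · have hβ : (starRingEnd ℂ) (β x) * β x = α x - α x * α x :=
      DFunLike.congr_fun h.star_mul_self x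
    rw [Complex.conj_mul', hx] at hβ
    exact (by simpa using hβ : β x = 0).symm
  · rw [bZeta_apply, h.one_add_norm_div_sq hx, inv_inv, div_mul_cancel₀ _ hx]

/-- The Gelfand transform turns `a` and `b` into functions `α` and `β` on the spectrum, where
composition with `β / α` is available. -/
theorem IsResolventPair.exists_starAlgHom_of_commCStarAlgebra {R : Type*} [CommCStarAlgebra R]
    {a b : R} (h : IsResolventPair a b) :
    ∃ φ : Unitization ℂ C₀(ℂ, ℂ) →⋆ₐ[ℂ] R, φ aZeta = a ∧ φ bZeta = b := by
  have h' := h.map (gelfandStarTransform R)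
  refine ⟨((gelfandStarTransform R).symm : _ →⋆ₐ[ℂ] R).comp (Unitization.starLift h'.compDiv),
    ?_, ?_⟩
  · refine (congrArg (gelfandStarTransform R).symm ?_).trans
      ((gelfandStarTransform R).symm_apply_apply a)
    exact (Unitization.starLift_symm_apply_apply _ _).symm.trans
      ((DFunLike.congr_fun (Equiv.symm_apply_apply _ _) _).trans h'.compDiv_aZeta)
  · refine (congrArg (gelfandStarTransform R).symm ?_).trans
      ((gelfandStarTransform R).symm_apply_apply b)
    exact (Unitization.starLift_symm_apply_apply _ _).symm.trans
      ((DFunLike.congr_fun (Equiv.symm_apply_apply _ _) _).trans h'.compDiv_bZeta)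

/-- A resolvent pair in a C⋆-algebra is the image of `(a_ζ, b_ζ)`. -/
theorem IsResolventPair.exists_starAlgHom {R : Type*} [CStarAlgebra R]
    {a b : R} (h : IsResolventPair a b) :
    ∃ φ : Unitization ℂ C₀(ℂ, ℂ) →⋆ₐ[ℂ] R, φ aZeta = a ∧ φ bZeta = b := by
  let S : StarSubalgebra ℂ R := (StarAlgebra.adjoin ℂ {a, b}).topologicalClosure
  have hS : IsClosed (S : Set R) := StarSubalgebra.isClosed_topologicalClosure _
  have haS : a ∈ S := StarSubalgebra.le_topologicalClosure _
    (StarAlgebra.subset_adjoin ℂ _ (by simp))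
  have hbS : b ∈ S := StarSubalgebra.le_topologicalClosure _
    (StarAlgebra.subset_adjoin ℂ _ (by simp))
  have hb : b * star b = star b * b := h.mul_star_self.trans h.star_mul_self.symm
  -- The element `a` is self-adjoint, `b` is normal, and they commute.
  have hcomm := StarAlgebra.isMulCommutative_adjoin ℂ (s := {a, b})
    (by simp [h.commute]) (by simp [h.star_left, h.commute, h.commute_star, hb])
  let _ : CommCStarAlgebra S :=
    { StarSubalgebra.cstarAlgebra S with
      mul_comm := (StarSubalgebra.commRingTopologicalClosure _ hcomm.is_comm.comm).mul_comm }
  have hpair : IsResolventPair (⟨a, haS⟩ : S) ⟨b, hbS⟩ :=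
    ⟨Subtype.ext h.star_left, Subtype.ext h.star_mul_self, Subtype.ext h.mul_star_self,
      Subtype.ext h.commute⟩
  obtain ⟨φ, hφa, hφb⟩ := hpair.exists_starAlgHom_of_commCStarAlgebra
  exact ⟨S.subtype.comp φ, congrArg Subtype.val hφa, congrArg Subtype.val hφb⟩

/-- A continuous function on the one-point compactification minus its value at `∞`. -/
def onePointSub (g : C(OnePoint ℂ, ℂ)) : C₀(ℂ, ℂ) where
  toFun z := g z - g OnePoint.infty
  continuous_toFun := (g.continuous.comp OnePoint.continuous_coe).sub continuous_const
  zero_at_infty' := by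
    have h := ((OnePoint.continuous_iff g).1 g.continuous).1
    rw [coclosedCompact_eq_cocompact] at h
    simpa using h.sub_const (g OnePoint.infty)

@[simp]
theorem onePointSub_apply (g : C(OnePoint ℂ, ℂ)) (z : ℂ) :
    onePointSub g z = g z - g OnePoint.infty := rfl

/-- The continuous functions on the one-point compactification as elements of the unitization
of the functions vanishing at infinity. -/
def onePointToUnitization : C(OnePoint ℂ, ℂ) →⋆ₐ[ℂ] Unitization ℂ C₀(ℂ, ℂ) where
  toFun g := Unitization.inl (g OnePoint.infty) + Unitization.inr (onePointSub g)
  map_one' := by ext <;> simp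
  map_mul' f g := by
    ext z
    · simp
    · simp; ring
  map_zero' := by ext <;> simp
  map_add' f g := by
    ext z
    · simp
    · simp; ring
  commutes' c := by ext <;> simp [Unitization.algebraMap_eq_inl]
  map_star' g := by ext <;> simp

/-- The continuous extension of `c + f` to the one-point compactification, for `f` vanishing at
infinity. -/
def onePointExtension (c : ℂ) (f : C₀(ℂ, ℂ)) : C(OnePoint ℂ, ℂ) :=
  OnePoint.continuousMapMk ⟨fun z => c + f z, by fun_prop⟩ c (by
    rw [coclosedCompact_eq_cocompact]
    simpa using (zero_at_infty f).const_add c)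

theorem onePointExtension_coe (c : ℂ) (f : C₀(ℂ, ℂ)) (z : ℂ) :
    onePointExtension c f z = c + f z := rfl

theorem onePointExtension_infty (c : ℂ) (f : C₀(ℂ, ℂ)) :
    onePointExtension c f OnePoint.infty = c := rfl

theorem onePointToUnitization_extension (c : ℂ) (f : C₀(ℂ, ℂ)) :
    onePointToUnitization (onePointExtension c f) = Unitization.inl c + Unitization.inr f := by
  ext z
  · simp [onePointToUnitization, onePointExtension_infty]
  · simp [onePointToUnitization, onePointExtension_infty, onePointExtension_coe]

open scoped CStarAlgebra in
/-- Unital star homomorphisms on `C₀(ℂ)^~` are determined by their values at `a_ζ` and `b_ζ`. -/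
theorem unitization_starAlgHom_ext {R : Type*} [CStarAlgebra R]
    {φ ψ : Unitization ℂ C₀(ℂ, ℂ) →⋆ₐ[ℂ] R} (ha : φ aZeta = ψ aZeta) (hb : φ bZeta = ψ bZeta) :
    φ = ψ := by
  let φ' := φ.comp onePointToUnitization
  let ψ' := ψ.comp onePointToUnitization
  let S : StarSubalgebra ℂ C(OnePoint ℂ, ℂ) := StarAlgHom.equalizer φ' ψ'
  have hmem : ∀ f : C₀(ℂ, ℂ), φ f = ψ f → onePointExtension 0 f ∈ S := fun f hf => by
    change φ (onePointToUnitization _) = ψ (onePointToUnitization _)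
    simpa [onePointToUnitization_extension] using hf
  -- Only at `∞` does `a_ζ` vanish, and `b_ζ / a_ζ` is the identity on `ℂ`.
  have hsep : S.SeparatesPoints := by
    intro x y hxy
    by_contra! hS
    have h : ∀ f : C₀(ℂ, ℂ), φ f = ψ f → onePointExtension 0 f x = onePointExtension 0 f y :=
      fun f hf => hS _ ⟨_, hmem f hf, rfl⟩
    have hax := h _ ha
    have hbx := h _ hb
    induction x using OnePoint.rec with
    | infty =>
      induction y using OnePoint.rec with
      | infty => exact hxy rfl
      | coe y =>
        rw [onePointExtension_infty, onePointExtension_coe, zero_add] at hax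
        exact aZeta_ne_zero y hax.symm
    | coe x =>
      induction y using OnePoint.rec with
      | infty =>
        rw [onePointExtension_infty, onePointExtension_coe, zero_add] at hax
        exact aZeta_ne_zero x hax
      | coe y =>
        simp only [onePointExtension_coe, zero_add] at hax hbx
        rw [bZeta_eq_mul_aZeta, bZeta_eq_mul_aZeta, ← hax] at hbx
        exact hxy (congrArg _ (mul_right_cancel₀ (aZeta_ne_zero x) hbx))
  have htop : ∀ g, g ∈ S := fun g => by
    -- The equalizer is closed because star homomorphisms between C⋆-algebras are continuous.
    have hle : S.topologicalClosure ≤ S :=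
      StarSubalgebra.topologicalClosure_minimal le_rfl
        (isClosed_eq (map_continuous φ') (map_continuous ψ'))
    rw [ContinuousMap.starSubalgebra_topologicalClosure_eq_top_of_separatesPoints S hsep] at hle
    exact hle StarSubalgebra.mem_top
  refine StarAlgHom.ext fun u => ?_
  have hu : onePointToUnitization (onePointExtension u.fst u.snd) = u := by
    rw [onePointToUnitization_extension, Unitization.inl_fst_add_inr_snd_eq]
  rw [← hu]
  exact htop _

end ZetaCalculus

/-! ### Graphs, projections and resolvent pairs -/

section Graph

variable {A E : Type*} [NonUnitalCStarAlgebra A] [PartialOrder A] [StarOrderedRing A]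
  [NormedAddCommGroup E] [NormedSpace ℂ E] [SMul A E] [CStarModule A E]

theorem inner_star_left (T : Adjointable A E) (x y : E) :
    inner A ((star T).1 x) y = inner A x (T.1 y) := by
  rw [inner_star_right, star_star]

theorem IsResolventPair.apply_relations {a b : Adjointable A E} (h : IsResolventPair a b) (x : E) :
    (star b).1 (b.1 x) = a.1 x - a.1 (a.1 x) ∧ b.1 ((star b).1 x) = a.1 x - a.1 (a.1 x) ∧
      a.1 (b.1 x) = b.1 (a.1 x) ∧ (star b).1 (a.1 x) = a.1 ((star b).1 x) :=
  ⟨congrArg (fun T : Adjointable A E => T.1 x) h.star_mul_self,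
    congrArg (fun T : Adjointable A E => T.1 x) h.mul_star_self,
    congrArg (fun T : Adjointable A E => T.1 x) h.commute,
    congrArg (fun T : Adjointable A E => T.1 x) h.commute_star⟩

/-- The range of the projection of `E ⊕ E` with matrix `!![a, b^*; b, 1 - a]`, for a resolvent
pair `(a, b)`. -/
def resolventGraph (a b : Adjointable A E) : Set (E × E) :=
  {r | (star b).1 r.2 = r.1 - a.1 r.1 ∧ b.1 r.1 = a.1 r.2}

/-- The orthogonal complement of a range is the kernel of the adjoint map. -/
theorem IsResolventPair.mem_orthSum_range {a b : Adjointable A E} (h : IsResolventPair a b)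
    (q : E × E) :
    q ∈ orthSum A (Set.range fun x : E => (a.1 x, b.1 x)) ↔ a.1 q.1 + (star b).1 q.2 = 0 := by
  have key : ∀ x, inner A q.1 (a.1 x) + inner A q.2 (b.1 x) =
      inner A (a.1 q.1 + (star b).1 q.2) x := fun x => by
    rw [CStarModule.inner_add_left, inner_star_left, ← inner_star_left a, h.star_left]
  constructor
  · intro hq
    rw [← CStarModule.inner_self (A := A), ← key]
    exact hq _ ⟨_, rfl⟩
  · rintro hq _ ⟨x, rfl⟩
    change inner A q.1 (a.1 x) + inner A q.2 (b.1 x) = 0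
    rw [key, hq, CStarModule.inner_zero_left]

/-- Let `P` be the projection `!![a, b^*; b, 1 - a]`. The range of `1 - P` lies in the first
complement, so a vector of the second one is fixed by `P`. Conversely, the injectivity of `a` shows
that `P` kills the first complement, which is then orthogonal to the range of `P`. -/
theorem IsResolventPair.orthSum_orthSum_range {a b : Adjointable A E} (h : IsResolventPair a b)
    (hker : ∀ x, a.1 x = 0 → x = 0) :
    orthSum A (orthSum A (Set.range fun x : E => (a.1 x, b.1 x))) = resolventGraph a b := by
  have ha : ∀ x y, inner A (a.1 x) y = inner A x (a.1 y) := fun x y => by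
    rw [inner_star_right, h.star_left]
  ext r
  constructor
  · intro hr
    have key : ∀ q₁ q₂ : E, inner A (r.1 - a.1 r.1 - (star b).1 r.2) q₁ +
        inner A (a.1 r.2 - b.1 r.1) q₂ = 0 := fun q₁ q₂ => by
      -- This vector is `(1 - P) (q₁, q₂)`.
      have hq : (q₁ - a.1 q₁ - (star b).1 q₂, a.1 q₂ - b.1 q₁) ∈
          orthSum A (Set.range fun x : E => (a.1 x, b.1 x)) := by
        rw [h.mem_orthSum_range]
        simp only [map_sub, (h.apply_relations q₁).1, (h.apply_relations q₂).2.2.2]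
        abel
      have := hr _ hq
      simp only [CStarModule.inner_sub_right, CStarModule.inner_sub_left, ha, inner_star_left,
        inner_star_right b] at this ⊢
      rw [← this]
      abel
    constructor
    · have := key (r.1 - a.1 r.1 - (star b).1 r.2) 0
      rw [CStarModule.inner_zero_right, add_zero, CStarModule.inner_self, sub_eq_zero] at this
      exact this.symm
    · have := key 0 (a.1 r.2 - b.1 r.1)
      rw [CStarModule.inner_zero_right, zero_add, CStarModule.inner_self, sub_eq_zero] at this
      exact this.symm
  · rintro ⟨hr₁, hr₂⟩ q hq
    rw [h.mem_orthSum_range] at hq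
    -- The second row of `P q`: `a` maps it to `b` applied to the first row, which is zero.
    have hq' : b.1 q.1 + (q.2 - a.1 q.2) = 0 := by
      refine hker _ ?_
      have := congrArg b.1 hq
      rw [map_add, map_zero, (h.apply_relations q.2).2.1] at this
      rw [map_add, map_sub, (h.apply_relations q.1).2.2.1, this]
    have e₁ : r.1 = a.1 r.1 + (star b).1 r.2 := by rw [hr₁]; abel
    have e₂ : r.2 = b.1 r.1 + (r.2 - a.1 r.2) := by rw [hr₂]; abel
    have : inner A r.1 q.1 + inner A r.2 q.2 =
        inner A r.1 (a.1 q.1 + (star b).1 q.2) + inner A r.2 (b.1 q.1 + (q.2 - a.1 q.2)) := by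
      refine (congrArg₂ (· + ·) (congrArg (inner A · q.1) e₁)
        (congrArg (inner A · q.2) e₂)).trans ?_
      simp only [CStarModule.inner_add_left, CStarModule.inner_add_right,
        CStarModule.inner_sub_left, CStarModule.inner_sub_right, ha, inner_star_left,
        inner_star_right b]
      abel
    rw [this, hq, hq', CStarModule.inner_zero_right, CStarModule.inner_zero_right, add_zero]

theorem IsResolventPair.mem_resolventGraph {a b : Adjointable A E} (h : IsResolventPair a b)
    (x : E) : (a.1 x, b.1 x) ∈ resolventGraph a b :=
  ⟨(h.apply_relations x).1, (h.apply_relations x).2.2.1.symm⟩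

theorem IsResolventPair.mem_resolventGraph' {a b : Adjointable A E} (h : IsResolventPair a b)
    (x : E) : ((star b).1 x, x - a.1 x) ∈ resolventGraph a b := by
  constructor
  · simp only [map_sub, (h.apply_relations x).2.2.2]
  · simp only [map_sub, (h.apply_relations x).2.1]

/-- A resolvent pair is determined by its graph. -/
theorem IsResolventPair.eq_of_resolventGraph_eq {a b a' b' : Adjointable A E}
    (h : IsResolventPair a b) (h' : IsResolventPair a' b')
    (hG : resolventGraph a b = resolventGraph a' b') : a = a' ∧ b = b' := by
  -- Projections with the same range satisfy `P' P = P` and `P P' = P'`; taking adjoints gives `P =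
  -- P'`. The identities used are entries of these products.
  have h₁ : star b' * b = a - a' * a := by
    ext x; exact (hG ▸ h.mem_resolventGraph x).1
  have h₂ : star b * b' = a' - a * a' := by
    ext x; exact (hG ▸ h'.mem_resolventGraph x).1
  have haa : a = a' := by
    have := congrArg star h₂
    simp only [star_mul, star_sub, star_star, h.star_left, h'.star_left] at this
    exact sub_left_injective (h₁.symm.trans this)
  subst haa
  have h₃ : star b' - star b' * a = star b - a * star b := by
    ext x; exact (map_sub _ _ _).symm.trans (hG ▸ h.mem_resolventGraph' x).1
  refine ⟨rfl, ?_⟩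
  have h₄ : b' * a = a * b := by
    ext x; exact (hG ▸ h.mem_resolventGraph x).2
  have h₅ := congrArg star h₃
  simp only [star_mul, star_sub, star_star, h.star_left] at h₅
  rw [h'.commute, h₄, ← h.commute] at h₅
  exact sub_left_injective h₅.symm

/-! ### The resolvent pair of a normal operator -/

variable [CompleteSpace E]

/-- The resolvent pair `((1 + t^* t)⁻¹, t (1 + t^* t)⁻¹)` of a normal graph regular operator. -/
theorem exists_isResolventPair {t : E →ₗ.[ℂ] E} (ht : IsGraphRegular A t)
    (hn : IsNormalOp A t) :
    ∃ a b : Adjointable A E, IsResolventPair a b ∧ (∀ x, a.1 x = 0 → x = 0) ∧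
      (t.graph : Set (E × E)) = resolventGraph a b := by
  have hdec : ∀ v : E × E, ∃ q ∈ t.graph, v - q ∈ orthSum A (t.graph : Set (E × E)) := fun v => by
    obtain ⟨q, hq, r, hr, rfl⟩ := ht.complemented v
    exact ⟨q, hq, by rwa [add_sub_cancel_left]⟩
  choose p hp hp' using hdec
  have hp₂ : ∀ v w, w ∈ t.graph →
      inner A v.1 w.1 + inner A v.2 w.2 = inner A (p v).1 w.1 + inner A (p v).2 w.2 :=
    fun v w hw => by
      have := hp' v w hw
      simp only [Prod.fst_sub, Prod.snd_sub, CStarModule.inner_sub_left] at this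
      rw [← sub_eq_zero, ← this]
      abel
  have hp₁ : ∀ v w, v ∈ t.graph →
      inner A v.1 w.1 + inner A v.2 w.2 = inner A v.1 (p w).1 + inner A v.2 (p w).2 :=
    fun v w hv => by
      have := congrArg star (hp₂ w v hv)
      simpa using this
  have hsymm : ∀ v w, inner A (p v).1 w.1 + inner A (p v).2 w.2 =
      inner A v.1 (p w).1 + inner A v.2 (p w).2 := fun v w =>
    (hp₁ _ _ (hp v)).trans (hp₂ _ _ (hp w)).symm
  have huniq : ∀ v q, q ∈ t.graph → v - q ∈ orthSum A (t.graph : Set (E × E)) → p v = q :=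
    fun v q hq hvq => by
      have hm : p v - q ∈ t.graph := t.graph.sub_mem (hp v) hq
      have h₁ := hp₂ v _ hm
      have h₂ := hvq _ hm
      simp only [Prod.fst_sub, Prod.snd_sub, CStarModule.inner_sub_left] at h₂
      have h₃ : inner A ((p v).1 - q.1) ((p v).1 - q.1) +
          inner A ((p v).2 - q.2) ((p v).2 - q.2) = 0 := by
        rw [CStarModule.inner_sub_left, CStarModule.inner_sub_left, sub_add_sub_comm]
        rw [sub_add_sub_comm] at h₂
        rw [← h₂]
        exact congrArg (· - _) h₁.symm
      have h₄ := (add_eq_zero_iff_of_nonneg CStarModule.inner_self_nonneg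
        CStarModule.inner_self_nonneg).1 h₃
      rw [CStarModule.inner_self, CStarModule.inner_self, sub_eq_zero, sub_eq_zero] at h₄
      exact Prod.ext h₄.1 h₄.2
  have hadd : ∀ v w, p (v + w) = p v + p w := fun v w => by
    refine huniq _ _ (t.graph.add_mem (hp v) (hp w)) fun q hq => ?_
    have h₁ := hp' v q hq
    have h₂ := hp' w q hq
    rw [add_sub_add_comm]
    simp only [Prod.fst_add, Prod.snd_add, CStarModule.inner_add_left]
    rw [add_add_add_comm, h₁, h₂, add_zero]
  have hidem : ∀ v, v ∈ t.graph → p v = v := fun v hv =>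
    huniq v v hv fun q hq => by simp
  -- The matrix entries of the orthogonal projection `p` onto the graph are adjointable because `p`
  -- is symmetric.
  obtain ⟨a, ha, ha'⟩ := exists_adjointable (A := A) (f := fun x => (p (x, 0)).1)
    (g := fun x => (p (x, 0)).1) fun x y => by simpa using hsymm (x, 0) (y, 0)
  obtain ⟨b, hb, hb'⟩ := exists_adjointable (A := A) (f := fun x => (p (x, 0)).2)
    (g := fun y => (p (0, y)).1) fun x y => by simpa using hsymm (x, 0) (0, y)
  have hstar : star a = a := by
    ext x
    rw [ha', ha]
  have hpair : ∀ x u (hu : u ∈ t.domain),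
      inner A (x - a.1 x) u = inner A (b.1 x) (t ⟨u, hu⟩) := fun x u hu => by
    have := hp' (x, 0) (u, t ⟨u, hu⟩) (t.mem_graph ⟨u, hu⟩)
    simp only [Prod.fst_sub, Prod.snd_sub, ← ha, ← hb, zero_sub, CStarModule.inner_neg_left] at this
    exact add_neg_eq_zero.1 this
  have hmem : ∀ x, (a.1 x, b.1 x) ∈ t.graph := fun x => by
    rw [ha, hb]; exact hp _
  -- The only use of normality. As `t^* t (a x) = x - a x`, also `t t^* (a x) = x - a x`. With `y =
  -- t^* (a x)`, the vector `(y, x - a x)` lies in the graph and `(0, x) - (y, x - a x) = (-y, a x)`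
  -- is orthogonal to it.
  have hc : ∀ x, (p (0, x)).2 = x - a.1 x := fun x => by
    obtain ⟨y, hy, hy'⟩ := (hn (a.1 x) (x - a.1 x)).1 ⟨b.1 x, hmem x, fun u => by
      have := congrArg star (hpair x u u.2)
      simpa only [CStarModule.star_inner] using this.symm⟩
    rw [huniq (0, x) (y, x - a.1 x) hy' ?_]
    intro q hq
    obtain ⟨u, hu₁, hu₂⟩ := (LinearPMap.mem_graph_iff t).1 hq
    have := congrArg star (hy u)
    simp only [CStarModule.star_inner] at this
    simp only [Prod.fst_sub, Prod.snd_sub, zero_sub, CStarModule.inner_neg_left, sub_sub_cancel,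
      ← hu₁, ← hu₂, this, neg_add_cancel]
  have hpv : ∀ v, p v = (a.1 v.1 + (star b).1 v.2, b.1 v.1 + (v.2 - a.1 v.2)) := fun v => by
    have : v = (v.1, 0) + (0, v.2) := by simp
    conv_lhs => rw [this, hadd]
    rw [ha, hb, hb', ← hc]
    rfl
  have hgraph : (t.graph : Set (E × E)) = resolventGraph a b := by
    ext v
    have : v ∈ t.graph ↔ p v = v := ⟨hidem v, fun h => h ▸ hp v⟩
    rw [SetLike.mem_coe, this, hpv, Prod.ext_iff]
    refine and_congr ?_ ?_
    · rw [eq_sub_iff_add_eq']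
    · change b.1 v.1 + (v.2 - a.1 v.2) = v.2 ↔ _
      rw [add_sub_left_comm, add_eq_left, sub_eq_zero]
  have hcol₁ : ∀ x, (a.1 x, b.1 x) ∈ resolventGraph a b := fun x => hgraph ▸ hmem x
  have hcol₂ : ∀ x, ((star b).1 x, x - a.1 x) ∈ resolventGraph a b := fun x => by
    rw [← hgraph, hb', ← hc]
    exact hp _
  have h₁ : star b * b = a - a * a := by
    ext x; exact (hcol₁ x).1
  refine ⟨a, b, ⟨hstar, h₁, ?_, ?_⟩, fun x hx => ?_, hgraph⟩
  · ext x
    exact (hcol₂ x).2.trans (map_sub _ _ _)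
  · ext x; exact (hcol₁ x).2.symm
  -- If `a x = 0`, then `b^* b = a - a²` gives `b x = 0`. Hence `p (x, 0) = 0`, and `x` is
  -- orthogonal to the domain.
  · have hbx : b.1 x = 0 := by
      rw [← CStarModule.inner_self (A := A), inner_star_right]
      have := congrArg (fun T : Adjointable A E => T.1 x) h₁
      change (star b).1 (b.1 x) = a.1 x - a.1 (a.1 x) at this
      rw [this, hx, map_zero, sub_zero, CStarModule.inner_zero_right]
    refine ht.essentiallyDefined x fun u hu => ?_
    have := hpair x u hu
    rwa [hx, hbx, sub_zero, CStarModule.inner_zero_left] at this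

end Graph

/-! ### Unitality and the main theorem -/

section Main

variable {A E : Type*} [NonUnitalCStarAlgebra A] [PartialOrder A] [StarOrderedRing A]
  [NormedAddCommGroup E] [NormedSpace ℂ E] [SMul A E] [CStarModule A E]

theorem isResolventPair_map (ψ : Unitization ℂ C₀(ℂ, ℂ) →⋆ₙₐ[ℂ] Adjointable A E) :
    IsResolventPair (ψ aZeta) (ψ bZeta) :=
  (isResolventPair_aZeta_bZeta.map (Unitization.inrNonUnitalStarAlgHom ℂ C₀(ℂ, ℂ))).map ψ

/-- A star homomorphism with `𝒩(φ(a_ζ)) = {0}` is unital. -/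
theorem HasTrivialNullSpace.map_one {ψ : Unitization ℂ C₀(ℂ, ℂ) →⋆ₙₐ[ℂ] Adjointable A E}
    (hψ : HasTrivialNullSpace ψ) : ψ 1 = 1 := by
  ext x
  refine sub_eq_zero.1 (hψ _ ?_)
  have h : ψ aZeta * ψ 1 = ψ aZeta := by rw [← map_mul, mul_one]
  have := congrArg (fun T : Adjointable A E => T.1 x) h
  rw [map_sub, sub_eq_zero]
  exact this

end Main

end GraphRegular

end

theorem theorem4p23 {A E : Type*} [NonUnitalCStarAlgebra A] [PartialOrder A] [StarOrderedRing A]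
    [NormedAddCommGroup E] [NormedSpace ℂ E] [CompleteSpace E] [SMul A E] [CStarModule A E]
    (t : E →ₗ.[ℂ] E) (ht : GraphRegular.IsGraphRegular A t) (hn : GraphRegular.IsNormalOp A t) :
    ∃ φ : Unitization ℂ C₀(ℂ, ℂ) →⋆ₐ[ℂ] GraphRegular.Adjointable A E,
      GraphRegular.IsFunctionalCalculus t
          (φ : Unitization ℂ C₀(ℂ, ℂ) →⋆ₙₐ[ℂ] GraphRegular.Adjointable A E) ∧
        ∀ ψ : Unitization ℂ C₀(ℂ, ℂ) →⋆ₙₐ[ℂ] GraphRegular.Adjointable A E,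
          GraphRegular.IsFunctionalCalculus t ψ →
            ψ = (φ : Unitization ℂ C₀(ℂ, ℂ) →⋆ₙₐ[ℂ] GraphRegular.Adjointable A E) := by
  obtain ⟨a, b, hab, hker, hG⟩ := GraphRegular.exists_isResolventPair ht hn
  obtain ⟨φ, hφa, hφb⟩ := hab.exists_starAlgHom
  refine ⟨φ, ⟨fun x hx => hker x (by rwa [← hφa]), ?_⟩, fun ψ hψ => ?_⟩
  · rw [hG, ← hab.orthSum_orthSum_range hker, ← hφa, ← hφb]
    rfl
  · have hpair := GraphRegular.isResolventPair_map ψ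
    have hgraph := (hpair.orthSum_orthSum_range hψ.1).symm.trans (hψ.2.trans hG)
    obtain ⟨ha, hb⟩ := hpair.eq_of_resolventGraph_eq hab hgraph
    -- The trivial null space makes `ψ` unital, so the uniqueness of unital homomorphisms applies to
    -- it.
    let ψ' : Unitization ℂ C₀(ℂ, ℂ) →⋆ₐ[ℂ] GraphRegular.Adjointable A E :=
      { ψ with
        map_one' := hψ.1.map_one
        commutes' := fun c => by
          change ψ (algebraMap ℂ _ c) = _
          rw [Algebra.algebraMap_eq_smul_one, Algebra.algebraMap_eq_smul_one, map_smul,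
            hψ.1.map_one] }
    have h : ψ' = φ :=
      GraphRegular.unitization_starAlgHom_ext (ha.trans hφa.symm) (hb.trans hφb.symm)
    rw [← h]
    rfl
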